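/- All digraphs are finite, without loops and multiple arcs; a local tournament is a digraph with no 2-cycle in which, for every vertex $x$, the out-neighbourhood $N^+(x)$ and the in-neighbourhood $N^-(x)$ both induce semicomplete digraphs (any two distinct vertices are joined by an arc in at least one direction). A tournament is a semicomplete digraph with no 2-cycle. A digraph on $n\ge 1$ vertices is round if its vertices can be labelled $v_1,\dots,v_n$ (subscripts modulo $n$) so that for each $i$ one has $N^+(v_i)=\{v_{i+1},\dots,v_{i+d^+(v_i)}\}$ and $N^-(v_i)=\{v_{i-d^-(v_i)},\dots,v_{i-1}\}$. A digraph $D$ is round decomposable if $D=R[S_1,\dots,S_r]$ for some round local tournament $R$ on $r\ge 2$ vertices $w_1,\dots,w_r$ and some nonempty, pairwise vertex-disjoint, strong semicomplete digraphs $S_1,\dots,S_r$; here $R[S_1,\dots,S_r]$ has vertex set $\bigcup_i V(S_i)$, and its arcs are the arcs of the $S_i$ together with all $x\to y$ with $x\in V(S_i)$, $y\in V(S_j)$ and $w_i\to w_j$ in $R$. Write $d^+(v)$, $d^-(v)$ for the out-degree and in-degree of $v$, and $d^{++}(v)$ for the cardinality of $\bigcup_{u\in N^+(v)}N^+(u)\setminus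 N^+(v)$. A vertex $v$ is a Sullivan-2 vertex of $D$ if $d^{++}(v)+d^+(v)\ge 2d^-(v)$. **Theorem.** Let $D$ be a local tournament that is not round decomposable and is not a tournament. Then either $D$ has at least two Sullivan-2 vertices, or $D$ has a Sullivan-2 vertex $v$ satisfying $d^{++}(v)+d^+(v)\ge 2d^-(v)+2$. -/

import Mathlib

namespace Digraph

variable {V W : Type*}

/-- The subdigraph of `D` induced by the vertex set `s`. -/
def inducedOn (D : Digraph V) (s : Set V) : Digraph s where
  Adj x y := D.Adj x y

/-- `D` has no loops. -/
def Loopless (D : Digraph V) : Prop := ∀ x, ¬ D.Adj x x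

/-- `D` has no 2-cycle. -/
def NoTwoCycle (D : Digraph V) : Prop := ∀ x y, x ≠ y → ¬ (D.Adj x y ∧ D.Adj y x)

/-- The out-neighbourhood of `x`. -/
def outNbhd (D : Digraph V) (x : V) : Set V := {y | D.Adj x y}

/-- The in-neighbourhood of `x`. -/
def inNbhd (D : Digraph V) (x : V) : Set V := {y | D.Adj y x}

/-- The second out-neighbourhood of `x`: the out-neighbours of the out-neighbours of `x`, without
the out-neighbours of `x`. -/
def secondOutNbhd (D : Digraph V) (x : V) : Set V :=
  (⋃ u ∈ D.outNbhd x, D.outNbhd u) \ D.outNbhd x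

noncomputable def outDeg (D : Digraph V) (x : V) : ℕ := (D.outNbhd x).ncard

noncomputable def inDeg (D : Digraph V) (x : V) : ℕ := (D.inNbhd x).ncard

noncomputable def secondOutDeg (D : Digraph V) (x : V) : ℕ := (D.secondOutNbhd x).ncard

/-- `D` is semicomplete: any two distinct vertices are joined by an arc in at least one
direction. -/
def IsSemicomplete (D : Digraph V) : Prop := ∀ x y, x ≠ y → D.Adj x y ∨ D.Adj y x

/-- A tournament: a (loopless) semicomplete digraph with no 2-cycle. -/
structure IsTournament (D : Digraph V) : Prop where
  loopless : D.Loopless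
  semicomplete : D.IsSemicomplete
  noTwoCycle : D.NoTwoCycle

/-- `D` is locally semicomplete: the out-neighbourhood and the in-neighbourhood of every vertex
induce semicomplete digraphs. -/
def IsLocallySemicomplete (D : Digraph V) : Prop :=
  ∀ x, (D.inducedOn (D.outNbhd x)).IsSemicomplete ∧ (D.inducedOn (D.inNbhd x)).IsSemicomplete

/-- A local tournament: a (loopless) locally semicomplete digraph with no 2-cycle. -/
structure IsLocalTournament (D : Digraph V) : Prop where
  loopless : D.Loopless
  locallySemicomplete : D.IsLocallySemicomplete
  noTwoCycle : D.NoTwoCycle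

/-- `D` is strong: any vertex can be reached from any other along a directed path. -/
def IsStrong (D : Digraph V) : Prop := ∀ x y, Relation.ReflTransGen D.Adj x y

/-- `v` is a round labelling of `R` by the residues modulo `n`: the out-neighbours of `v i` are
the `d⁺` vertices that follow `v i`, its in-neighbours the `d⁻` vertices that precede it. -/
def IsRoundLabelling (R : Digraph W) {n : ℕ} (v : ZMod n ≃ W) : Prop :=
  ∀ i : ZMod n,
    R.outNbhd (v i) = {w | ∃ k : ℕ, 1 ≤ k ∧ k ≤ R.outDeg (v i) ∧ w = v (i + k)} ∧
    R.inNbhd (v i) = {w | ∃ k : ℕ, 1 ≤ k ∧ k ≤ R.inDeg (v i) ∧ w = v (i - k)}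

/-- `R` is a round digraph (on a finite nonempty vertex set). -/
def IsRound (R : Digraph W) : Prop :=
  ∃ n : ℕ, 0 < n ∧ ∃ v : ZMod n ≃ W, R.IsRoundLabelling v

/-- The composition `R[S₁, …, Sᵣ]` of pairwise disjoint digraphs whose vertex sets partition `V`:
the vertex set of `S i` is the fibre of `f : V → W` over `i`. Its arcs are the arcs of the `S i`
and all `x → y` with `x` in `S i`, `y` in `S j` and `i → j` an arc of `R`. -/
def composition (R : Digraph W) (f : V → W) (S : (i : W) → Digraph {x : V // f x = i}) :
    Digraph V where
  Adj x y := (∃ (i : W) (hx : f x = i) (hy : f y = i), (S i).Adj ⟨x, hx⟩ ⟨y, hy⟩) ∨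
    R.Adj (f x) (f y)

/-- `D` is round decomposable: `D = R[S₁, …, Sᵣ]` for a round local tournament `R` on `r ≥ 2`
vertices and strong semicomplete digraphs `Sᵢ`, each with at least one vertex. -/
def IsRoundDecomposable (D : Digraph V) : Prop :=
  ∃ (r : ℕ) (R : Digraph (Fin r)) (f : V → Fin r) (S : (i : Fin r) → Digraph {x : V // f x = i}),
    2 ≤ r ∧ R.IsLocalTournament ∧ R.IsRound ∧ Function.Surjective f ∧
    (∀ i, (S i).Loopless ∧ (S i).IsStrong ∧ (S i).IsSemicomplete) ∧
    D = R.composition f S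

/-- `x` is a Sullivan-2 vertex of `D`: `d⁺⁺(x) + d⁺(x) ≥ 2 d⁻(x)`. -/
def IsSullivanTwo (D : Digraph V) (x : V) : Prop :=
  D.secondOutDeg x + D.outDeg x ≥ 2 * D.inDeg x

end Digraph

/-!
The proof is a connectivity argument: a vertex in a smallest piece that can be cut off by few
in-neighbours has small in-degree, and its second out-neighbourhood is large because every other
cut is at least as large.

Fix a connected component `U` which is not a clique. Call a set `T ⊆ U` *separated* if some vertex
of `U` outside `T` is adjacent to no vertex of `T`, and write `∂T` for the set of in-neighbours of
`T` outside `T`. Let `κ` be the least value of `|∂T|` over all separated sets, and let a *fragment*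
be a separated set with `|∂T| = κ`. In an inclusion-minimal fragment `T` every proper part receives
an arc from the rest, and with the local tournament condition this forces `T` to be a tournament
which dominates `P = N⁺(T) \ (T ∪ ∂T)` completely. A vertex `v` of maximal out-degree in `T`
reaches, in at most two steps, all of `T`, all of `P` and all of `N⁺(P)`, while
`2 d⁻(v) ≤ 2 κ + |T| - 1` (`exists_mem_two_mul_inDeg_le`). So it is enough that `P` and
`N⁺(P) \ (P ∪ T)` have at least `κ` vertices each. For `P` this holds because the set `R` of vertices
not adjacent to `T` is separated and has `∂R ⊆ P`. For the second set, if some vertices of `R` are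
not reached from `P`, they form a separated set whose boundary lies in `N⁺(P) ∩ R`. Otherwise the
only vertices that can be missed form a subset `S₂` of `∂T`, and if `|S₂| ≥ |R|`, the initial
part of `S₂` is a fragment too, or else dominates all of `T ∪ P` and contains a vertex satisfying the
inequality with room to spare.

Whenever one of these bounds is attained, there is another fragment, disjoint from `T`. Hence
(`IsFragment.exists_disjoint_fragment`) either some vertex satisfies the inequality with slack two,
or there is a Sullivan-2 vertex in `T` and a fragment disjoint from `T`, which then yields a second
Sullivan-2 vertex. Finally, if all components are cliques there are at least two of them, and a
vertex of maximal out-degree in each component is a Sullivan-2 vertex.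
-/

namespace Digraph

open Finset

section

variable {V : Type*} {D : Digraph V}

/-! ### Reformulations of the local tournament condition -/

theorem IsLocalTournament.adj_of_common_in (h : D.IsLocalTournament) {x y z : V} (hy : D.Adj x y)
    (hz : D.Adj x z) (hne : y ≠ z) : D.Adj y z ∨ D.Adj z y :=
  (h.locallySemicomplete x).1 ⟨y, hy⟩ ⟨z, hz⟩ (fun e => hne (congrArg Subtype.val e))

theorem IsLocalTournament.adj_of_common_out (h : D.IsLocalTournament) {x y z : V} (hy : D.Adj y x)
    (hz : D.Adj z x) (hne : y ≠ z) : D.Adj y z ∨ D.Adj z y :=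
  (h.locallySemicomplete x).2 ⟨y, hy⟩ ⟨z, hz⟩ (fun e => hne (congrArg Subtype.val e))

theorem IsLocalTournament.asymm (h : D.IsLocalTournament) {x y : V} (hxy : D.Adj x y) :
    ¬ D.Adj y x := fun hyx => by
  by_cases e : x = y
  · subst e
    exact h.loopless x hxy
  · exact h.noTwoCycle x y e ⟨hxy, hyx⟩

/-- `y` can be reached from `x` along a directed walk of length one or two. -/
def ReachTwo (D : Digraph V) (x y : V) : Prop := D.Adj x y ∨ ∃ u, D.Adj x u ∧ D.Adj u y

/-- The vertices of `T` are pairwise adjacent. -/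
def IsCliqueOn (D : Digraph V) (T : Finset V) : Prop :=
  ∀ x ∈ T, ∀ y ∈ T, x ≠ y → D.Adj x y ∨ D.Adj y x

/-- No arc joins `w` to `T`, in either direction. -/
def NonadjTo (D : Digraph V) (w : V) (T : Finset V) : Prop :=
  ∀ t ∈ T, ¬ D.Adj w t ∧ ¬ D.Adj t w

/-- Every nonempty proper subset of `T` receives an arc from the rest of `T`; that is, `T` induces
a strong digraph. -/
def IsStrongOn (D : Digraph V) (T : Finset V) : Prop :=
  ∀ A ⊆ T, A.Nonempty → A ≠ T → ∃ x ∈ T, x ∉ A ∧ ∃ y ∈ A, D.Adj x y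

/-- If a strong set `T` sends an arc to `p` and receives none from `p`, it dominates `p`: the
out-neighbours of an in-neighbour of `p` are adjacent to `p`, so they are in-neighbours of `p`. -/
theorem IsStrongOn.dominates (h : D.IsLocalTournament) {T : Finset V} (hT : D.IsStrongOn T)
    {p : V} (hp : p ∉ T) (hno : ∀ t ∈ T, ¬ D.Adj p t) (hex : ∃ t ∈ T, D.Adj t p) :
    ∀ t ∈ T, D.Adj t p := by
  classical
  by_contra hcon
  push Not at hcon
  obtain ⟨t₁, ht₁, hn₁⟩ := hcon
  obtain ⟨t₀, ht₀, ha₀⟩ := hex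
  obtain ⟨x, hx, hxA, y, hy, hxy⟩ := hT (T.filter fun t => ¬ D.Adj t p) (filter_subset _ _)
    ⟨t₁, by simp [ht₁, hn₁]⟩ (fun e => by
      have : t₀ ∈ T.filter fun t => ¬ D.Adj t p := by
        rw [e]
        exact ht₀
      simp [ha₀] at this)
  simp only [mem_filter, not_and, not_not] at hxA hy
  have hne : y ≠ p := fun e => hp (e ▸ hy.1)
  rcases h.adj_of_common_in hxy (hxA hx) hne with h1 | h1
  · exact hy.2 h1
  · exact hno y hy.1 h1

theorem IsLocalTournament.isCliqueOn_of_dominates (h : D.IsLocalTournament) {T : Finset V} {p : V}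
    (hp : ∀ t ∈ T, D.Adj t p) : D.IsCliqueOn T :=
  fun x hx y hy hne => h.adj_of_common_out (hp x hx) (hp y hy) hne

end

section

open Classical

variable {V : Type*} {D : Digraph V}

/-! ### Counting degrees -/

/-- A vertex of maximal out-degree in a tournament reaches every other vertex in at most two steps,
and its in-degree does not exceed its out-degree. -/
theorem IsCliqueOn.exists_king (h : D.IsLocalTournament) {T : Finset V} (hT : D.IsCliqueOn T)
    (hne : T.Nonempty) : ∃ v ∈ T, (∀ x ∈ T, x ≠ v → D.ReachTwo v x) ∧
      2 * (T.filter fun x => D.Adj x v).card + 1 ≤ T.card := by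
  obtain ⟨v, hv, hmax⟩ := exists_max_image T (fun v => (T.filter fun x => D.Adj v x).card) hne
  have hsplit : ∀ w ∈ T, (T.filter fun x => D.Adj x w).card + (T.filter fun x => D.Adj w x).card
      + 1 = T.card := by
    intro w hw
    have hU : T = insert w ((T.filter fun x => D.Adj x w) ∪ (T.filter fun x => D.Adj w x)) := by
      ext x
      simp only [mem_insert, mem_union, mem_filter]
      constructor
      · intro hx
        by_cases e : x = w
        · exact Or.inl e
        · exact Or.inr ((hT x hx w hw e).imp (fun a => ⟨hx, a⟩) (fun a => ⟨hx, a⟩))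
      · rintro (rfl | ⟨hx, -⟩ | ⟨hx, -⟩) <;> assumption
    have hd : Disjoint (T.filter fun x => D.Adj x w) (T.filter fun x => D.Adj w x) := by
      rw [disjoint_filter]
      exact fun x _ h1 h2 => h.asymm h1 h2
    have hw' : w ∉ (T.filter fun x => D.Adj x w) ∪ (T.filter fun x => D.Adj w x) := by
      simp [h.loopless w]
    conv_rhs => rw [hU, card_insert_of_notMem hw', card_union_of_disjoint hd]
  refine ⟨v, hv, ?_, ?_⟩
  · intro x hx hxv
    by_contra hcon
    unfold ReachTwo at hcon
    push Not at hcon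
    -- An unreached `x` dominates `v` and every out-neighbour of `v` in `T`.
    have hsub : insert v (T.filter fun y => D.Adj v y) ⊆ T.filter fun y => D.Adj x y := by
      intro y hy
      simp only [mem_insert, mem_filter] at hy ⊢
      rcases hy with rfl | ⟨hyT, hy⟩
      · exact ⟨hv, (hT x hx y hv hxv).resolve_right hcon.1⟩
      · have : x ≠ y := fun e => hcon.1 (e ▸ hy)
        exact ⟨hyT, (hT x hx y hyT this).resolve_right (hcon.2 y hy)⟩
    have h1 := card_le_card hsub
    rw [card_insert_of_notMem (by simp [h.loopless v])] at h1
    have h2 := hmax x hx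
    omega
  · have hdc : ∑ w ∈ T, (T.filter fun x => D.Adj w x).card
        = ∑ w ∈ T, (T.filter fun x => D.Adj x w).card :=
      sum_card_bipartiteAbove_eq_sum_card_bipartiteBelow (s := T) (t := T) D.Adj
    have hle : ∑ w ∈ T, (T.filter fun x => D.Adj w x).card
        ≤ T.card * (T.filter fun x => D.Adj v x).card := by
      rw [← smul_eq_mul]
      exact sum_le_card_nsmul T _ _ hmax
    have hge : T.card * (T.filter fun x => D.Adj x v).card
        ≤ ∑ w ∈ T, (T.filter fun x => D.Adj x w).card := by
      rw [← smul_eq_mul]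
      refine card_nsmul_le_sum T _ _ fun w hw => ?_
      have := hsplit w hw
      have := hsplit v hv
      have := hmax w hw
      omega
    have hpos : 0 < T.card := hne.card_pos
    have := Nat.le_of_mul_le_mul_left (hge.trans (hdc ▸ hle)) hpos
    have := hsplit v hv
    omega

variable [Fintype V]

/-- The set of in-neighbours of `T` outside `T`. -/
noncomputable def inBoundary (D : Digraph V) (T : Finset V) : Finset V :=
  univ.filter fun x => x ∉ T ∧ ∃ t ∈ T, D.Adj x t

theorem mem_inBoundary {T : Finset V} {x : V} :
    x ∈ D.inBoundary T ↔ x ∉ T ∧ ∃ t ∈ T, D.Adj x t := by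
  simp [inBoundary]

theorem card_le_secondOutDeg_add_outDeg {v : V} {Q : Finset V} (hQ : ∀ q ∈ Q, D.ReachTwo v q) :
    Q.card ≤ D.secondOutDeg v + D.outDeg v := by
  rw [secondOutDeg, outDeg, ← Set.ncard_coe_finset Q]
  refine (Set.ncard_le_ncard ?_ (Set.toFinite _)).trans (Set.ncard_union_le _ _)
  intro q hq
  by_cases hv : D.Adj v q
  · exact Or.inr hv
  · rcases hQ q hq with h1 | ⟨u, hu, huq⟩
    · exact absurd h1 hv
    · exact Or.inl ⟨Set.mem_biUnion (x := u) hu huq, hv⟩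

theorem inDeg_le_card {v : V} {Q : Finset V} (hQ : ∀ x, D.Adj x v → x ∈ Q) :
    D.inDeg v ≤ Q.card := by
  rw [inDeg, ← Set.ncard_coe_finset Q]
  exact Set.ncard_le_ncard (fun x hx => hQ x hx) (Set.toFinite _)

/-- The basic estimate. If every vertex of the tournament `T` reaches all of `Q` in at most two
steps, a vertex of maximal out-degree in `T` has at least `|T| - 1 + |Q|` first and second
out-neighbours, whereas twice its in-degree is at most `|T| - 1 + 2 |∂T|`. -/
theorem exists_mem_two_mul_inDeg_le (h : D.IsLocalTournament) {T Q : Finset V}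
    (hT : D.IsCliqueOn T) (hne : T.Nonempty) (hd : Disjoint T Q)
    (hQ : ∀ t ∈ T, ∀ q ∈ Q, D.ReachTwo t q) :
    ∃ v ∈ T, 2 * D.inDeg v + Q.card
      ≤ D.secondOutDeg v + D.outDeg v + 2 * (D.inBoundary T).card := by
  obtain ⟨v, hv, hreach, hin⟩ := hT.exists_king h hne
  refine ⟨v, hv, ?_⟩
  have h1 : ((T.erase v) ∪ Q).card ≤ D.secondOutDeg v + D.outDeg v := by
    refine card_le_secondOutDeg_add_outDeg fun q hq => ?_
    rcases mem_union.1 hq with hq | hq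
    · exact hreach q (mem_of_mem_erase hq) (ne_of_mem_erase hq)
    · exact hQ v hv q hq
  rw [card_union_of_disjoint (hd.mono_left (erase_subset _ _)), card_erase_of_mem hv] at h1
  have h2 : D.inDeg v ≤ (D.inBoundary T ∪ T.filter fun x => D.Adj x v).card := by
    refine inDeg_le_card fun x hx => ?_
    by_cases hxT : x ∈ T
    · exact mem_union_right _ (mem_filter.2 ⟨hxT, hx⟩)
    · exact mem_union_left _ (mem_inBoundary.2 ⟨hxT, v, hv, hx⟩)
  have h3 := card_union_le (D.inBoundary T) (T.filter fun x => D.Adj x v)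
  omega

/-! ### Components and fragments -/

/-- `U` is the vertex set of a connected component: a minimal nonempty set closed under
adjacency. -/
structure IsComponentSet (D : Digraph V) (U : Finset V) : Prop where
  nonempty : U.Nonempty
  closed : ∀ x y, D.Adj x y → (x ∈ U ↔ y ∈ U)
  minimal : ∀ U' ⊆ U, U'.Nonempty → (∀ x y, D.Adj x y → (x ∈ U' ↔ y ∈ U')) → U' = U

/-- `T` is a nonempty subset of `U`, and some vertex of `U` outside `T` is adjacent to no vertex
of `T`. -/
structure IsSeparated (D : Digraph V) (U T : Finset V) : Prop where
  nonempty : T.Nonempty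
  subset : T ⊆ U
  exists_nonadj : ∃ w ∈ U, w ∉ T ∧ D.NonadjTo w T

/-- A separated set whose in-boundary is as small as possible. -/
structure IsFragment (D : Digraph V) (U T : Finset V) : Prop where
  separated : D.IsSeparated U T
  le : ∀ T', D.IsSeparated U T' → (D.inBoundary T).card ≤ (D.inBoundary T').card

theorem exists_card_minimal {p : Finset V → Prop} (hp : ∃ T, p T) :
    ∃ T, p T ∧ ∀ T', p T' → T.card ≤ T'.card := by
  obtain ⟨T₀, h₀⟩ := hp
  obtain ⟨T, hT, hmin⟩ := exists_min_image (univ.filter p) Finset.card ⟨T₀, by simp [h₀]⟩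
  exact ⟨T, (mem_filter.1 hT).2, fun T' h' => hmin T' (by simp [h'])⟩

theorem exists_isComponentSet_subset {W : Finset V} (hW : W.Nonempty)
    (hcl : ∀ x y, D.Adj x y → (x ∈ W ↔ y ∈ W)) : ∃ U ⊆ W, D.IsComponentSet U := by
  obtain ⟨U, ⟨hne, hcl', hsub⟩, hmin⟩ := exists_card_minimal
    (p := fun U => U.Nonempty ∧ (∀ x y, D.Adj x y → (x ∈ U ↔ y ∈ U)) ∧ U ⊆ W)
    ⟨W, hW, hcl, Subset.rfl⟩
  exact ⟨U, hsub, hne, hcl', fun U' hs hn hc =>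
    eq_of_subset_of_card_le hs (hmin U' ⟨hn, hc, hs.trans hsub⟩)⟩

theorem exists_isFragment {U : Finset V} (hU : ¬ D.IsCliqueOn U) : ∃ F, D.IsFragment U F := by
  unfold IsCliqueOn at hU
  push Not at hU
  obtain ⟨x, hx, y, hy, hne, h1, h2⟩ := hU
  have hs : D.IsSeparated U {x} :=
    ⟨singleton_nonempty x, by simpa using hx, y, hy, by simpa using hne.symm, by
      intro t ht
      rw [mem_singleton.1 ht]
      exact ⟨h2, h1⟩⟩
  obtain ⟨F, hF, hmin⟩ := exists_min_image (univ.filter fun T => D.IsSeparated U T)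
    (fun T => (D.inBoundary T).card) ⟨{x}, by simp [hs]⟩
  exact ⟨F, (mem_filter.1 hF).2, fun T' h' => hmin T' (by simp [h'])⟩

/-- A fragment of least cardinality inside a given fragment is strong: a part receiving no arc from
the rest would be a smaller fragment. -/
theorem IsFragment.exists_strong_subset {U F : Finset V} (hF : D.IsFragment U F) :
    ∃ T ⊆ F, D.IsFragment U T ∧ D.IsStrongOn T := by
  obtain ⟨T, ⟨hTF, hT⟩, hmin⟩ := exists_card_minimal
    (p := fun T => T ⊆ F ∧ D.IsFragment U T) ⟨F, Subset.rfl, hF⟩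
  refine ⟨T, hTF, hT, fun A hA hAne hAT => ?_⟩
  by_contra hcon
  push Not at hcon
  obtain ⟨w, hwU, hwT, hw⟩ := hT.separated.exists_nonadj
  have hAs : D.IsSeparated U A :=
    ⟨hAne, hA.trans hT.separated.subset, w, hwU, fun hwA => hwT (hA hwA), fun t ht => hw t (hA ht)⟩
  have hb : D.inBoundary A ⊆ D.inBoundary T := by
    intro x hx
    obtain ⟨hxA, a, ha, hxa⟩ := mem_inBoundary.1 hx
    exact mem_inBoundary.2 ⟨fun hxT => hcon x hxT hxA a ha hxa, a, hA ha, hxa⟩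
  have hAf : D.IsFragment U A := ⟨hAs, fun T' h' => (card_le_card hb).trans (hT.le T' h')⟩
  exact hAT (eq_of_subset_of_card_le hA (hmin A ⟨hA.trans hTF, hAf⟩))

/-- Every nonempty set `S` contains a nonempty strong set which receives no arc from the rest
of `S`. -/
theorem exists_initial_subset {S : Finset V} (hS : S.Nonempty) :
    ∃ T ⊆ S, T.Nonempty ∧ D.IsStrongOn T ∧ ∀ x ∈ S, x ∉ T → ∀ t ∈ T, ¬ D.Adj x t := by
  obtain ⟨T, ⟨hTS, hTne, hT⟩, hmin⟩ := exists_card_minimal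
    (p := fun T => T ⊆ S ∧ T.Nonempty ∧ ∀ x ∈ S, x ∉ T → ∀ t ∈ T, ¬ D.Adj x t)
    ⟨S, Subset.rfl, hS, fun x hx hx' => absurd hx hx'⟩
  refine ⟨T, hTS, hTne, fun A hA hAne hAT => ?_, hT⟩
  by_contra hcon
  push Not at hcon
  refine hAT (eq_of_subset_of_card_le hA (hmin A ⟨hA.trans hTS, hAne, fun x hx hxA a ha => ?_⟩))
  by_cases hxT : x ∈ T
  · exact hcon x hxT hxA a ha
  · exact hT x hx hxT a (hA ha)

/-- A vertex satisfying the Sullivan-2 inequality with slack two. -/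
def HasSlackVertex (D : Digraph V) : Prop :=
  ∃ v, 2 * D.inDeg v + 2 ≤ D.secondOutDeg v + D.outDeg v

/-- A fragment contains a Sullivan-2 vertex `v` such that some fragment misses `v`, unless the
digraph has a vertex with slack two. -/
theorem IsFragment.exists_disjoint_fragment (h : D.IsLocalTournament) {U F : Finset V}
    (hU : D.IsComponentSet U) (hF : D.IsFragment U F) :
    D.HasSlackVertex ∨ ∃ v ∈ F, D.IsSullivanTwo v ∧ ∃ F', D.IsFragment U F' ∧ v ∉ F' := by
  obtain ⟨T, hTF, hT, hstr⟩ := hF.exists_strong_subset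
  obtain ⟨w₀, hw₀U, hw₀T, hw₀⟩ := hT.separated.exists_nonadj
  obtain ⟨t₀, ht₀⟩ := hT.separated.nonempty
  have hTU := hT.separated.subset
  set S := D.inBoundary T with hS
  set P := univ.filter fun x => x ∉ T ∧ x ∉ S ∧ ∃ t ∈ T, D.Adj t x with hP
  set R := U.filter fun x => x ∉ T ∧ D.NonadjTo x T with hR
  have memS : ∀ {x}, x ∈ S ↔ x ∉ T ∧ ∃ t ∈ T, D.Adj x t := mem_inBoundary
  have memP : ∀ {x}, x ∈ P ↔ x ∉ T ∧ x ∉ S ∧ ∃ t ∈ T, D.Adj t x := by simp [hP]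
  have memR : ∀ {x}, x ∈ R ↔ x ∈ U ∧ x ∉ T ∧ D.NonadjTo x T := by simp [hR]
  have hSU : S ⊆ U := fun s hs => by
    obtain ⟨-, t, ht, hst⟩ := memS.1 hs
    exact (hU.closed _ _ hst).2 (hTU ht)
  have hPU : P ⊆ U := fun p hp => by
    obtain ⟨-, -, t, ht, htp⟩ := memP.1 hp
    exact (hU.closed _ _ htp).1 (hTU ht)
  have hcover : ∀ x ∈ U, x ∈ T ∨ x ∈ S ∨ x ∈ P ∨ x ∈ R := by
    intro x hx
    by_cases h1 : x ∈ T
    · exact Or.inl h1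
    by_cases h2 : x ∈ S
    · exact Or.inr (Or.inl h2)
    by_cases h3 : x ∈ P
    · exact Or.inr (Or.inr (Or.inl h3))
    refine Or.inr (Or.inr (Or.inr (memR.2 ⟨hx, h1, fun t ht => ⟨fun ha => ?_, fun ha => ?_⟩⟩)))
    · exact h2 (memS.2 ⟨h1, t, ht, ha⟩)
    · exact h3 (memP.2 ⟨h1, h2, t, ht, ha⟩)
  have hPT : ∀ p ∈ P, ∀ t ∈ T, ¬ D.Adj p t := fun p hp t ht ha =>
    (memP.1 hp).2.1 (memS.2 ⟨(memP.1 hp).1, t, ht, ha⟩)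
  have hTP : ∀ p ∈ P, ∀ t ∈ T, D.Adj t p := fun p hp =>
    hstr.dominates h (memP.1 hp).1 (hPT p hp) (memP.1 hp).2.2
  have hRT : ∀ r ∈ R, ∀ t ∈ T, ¬ D.Adj r t ∧ ¬ D.Adj t r := fun r hr => (memR.1 hr).2.2
  have hSR : ∀ s ∈ S, ∀ r ∈ R, ¬ D.Adj s r := by
    intro s hs r hr ha
    obtain ⟨-, t, ht, hst⟩ := memS.1 hs
    have hne : t ≠ r := fun e => (memR.1 hr).2.1 (e ▸ ht)
    rcases h.adj_of_common_in hst ha hne with h1 | h1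
    · exact (hRT r hr t ht).2 h1
    · exact (hRT r hr t ht).1 h1
  have hw₀R : w₀ ∈ R := memR.2 ⟨hw₀U, hw₀T, hw₀⟩
  -- Otherwise `T ∪ {s}` would be separated, with a smaller in-boundary.
  have hSin : ∀ s ∈ S, ∃ x, (x ∈ P ∨ x ∈ R) ∧ D.Adj x s := by
    intro s hs
    by_contra hcon
    push Not at hcon
    have hsep : D.IsSeparated U (insert s T) := by
      refine ⟨insert_nonempty _ _, insert_subset (hSU hs) hTU, w₀, hw₀U, ?_, ?_⟩
      · rw [mem_insert]
        rintro (rfl | h1)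
        · obtain ⟨-, t, ht, hst⟩ := memS.1 hs
          exact (hw₀ t ht).1 hst
        · exact hw₀T h1
      · intro t ht
        rcases mem_insert.1 ht with rfl | ht
        · exact ⟨hcon w₀ (Or.inr hw₀R), hSR t hs w₀ hw₀R⟩
        · exact hw₀ t ht
    have hb : D.inBoundary (insert s T) ⊆ S.erase s := by
      intro x hx
      obtain ⟨hx1, t, ht, hxt⟩ := mem_inBoundary.1 hx
      simp only [mem_insert, not_or] at hx1
      refine mem_erase.2 ⟨hx1.1, ?_⟩
      rcases mem_insert.1 ht with rfl | ht
      · rcases hcover x ((hU.closed _ _ hxt).2 (hSU hs)) with h1 | h1 | h1 | h1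
        · exact absurd h1 hx1.2
        · exact h1
        · exact absurd hxt (hcon x (Or.inl h1))
        · exact absurd hxt (hcon x (Or.inr h1))
      · exact memS.2 ⟨hx1.2, t, ht, hxt⟩
    have h1 := (hT.le _ hsep).trans (card_le_card hb)
    rw [← hS] at h1
    have h2 := card_erase_lt_of_mem hs
    omega
  have hTS : ∀ t ∈ T, ∀ s ∈ S, D.Adj t s → ∃ p ∈ P, D.Adj p s := by
    intro t ht s hs hts
    obtain ⟨x, hx, hxs⟩ := hSin s hs
    rcases hx with hx | hx
    · exact ⟨x, hx, hxs⟩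
    · have hne : x ≠ t := fun e => (memR.1 hx).2.1 (e ▸ ht)
      rcases h.adj_of_common_out hxs hts hne with h1 | h1
      · exact absurd h1 (hRT x hx t ht).1
      · exact absurd h1 (hRT x hx t ht).2
  have hRsep : D.IsSeparated U R :=
    ⟨⟨w₀, hw₀R⟩, filter_subset _ _, t₀, hTU ht₀, fun h1 => (memR.1 h1).2.1 ht₀,
      fun r hr => ⟨(hRT r hr t₀ ht₀).2, (hRT r hr t₀ ht₀).1⟩⟩
  have hRb : D.inBoundary R ⊆ P := by
    intro x hx
    obtain ⟨hxR, r, hr, hxr⟩ := mem_inBoundary.1 hx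
    rcases hcover x ((hU.closed _ _ hxr).2 (memR.1 hr).1) with h1 | h1 | h1 | h1
    · exact absurd hxr (hRT r hr x h1).2
    · exact absurd hxr (hSR x h1 r hr)
    · exact h1
    · exact absurd h1 hxR
  have hPcard : S.card ≤ P.card := (hT.le R hRsep).trans (card_le_card hRb)
  -- If `P` were empty then so would be `S`, and `T` would be closed under adjacency.
  have hPne : P.Nonempty := by
    by_contra hPe
    rw [not_nonempty_iff_eq_empty] at hPe
    have hSe : S = ∅ := card_eq_zero.1 (by simpa [hPe] using hPcard)
    have hcl : ∀ x y, D.Adj x y → (x ∈ T ↔ y ∈ T) := by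
      intro x y hxy
      constructor
      · intro hx
        by_contra hy
        have : y ∈ P := memP.2 ⟨hy, by simp [hSe], x, hx, hxy⟩
        simp [hPe] at this
      · intro hy
        by_contra hx
        have : x ∈ S := memS.2 ⟨hx, y, hy, hxy⟩
        simp [hSe] at this
    exact hw₀T (hU.minimal T hTU ⟨t₀, ht₀⟩ hcl ▸ hw₀U)
  obtain ⟨p₀, hp₀⟩ := hPne
  have hTcl : D.IsCliqueOn T := h.isCliqueOn_of_dominates (hTP p₀ hp₀)
  set R₁ := R.filter fun x => ∃ p ∈ P, D.Adj p x with hR₁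
  set S₁ := S.filter fun x => ∃ p ∈ P, D.Adj p x with hS₁
  set S₂ := S.filter fun x => ¬ ∃ p ∈ P, D.Adj p x with hS₂
  have hScard : S₁.card + S₂.card = S.card := card_filter_add_card_filter_not _
  have hdSR : Disjoint S R := by
    rw [Finset.disjoint_left]
    intro x hx hx'
    obtain ⟨-, t, ht, hxt⟩ := memS.1 hx
    exact (hRT x hx' t ht).1 hxt
  have hdPR : Disjoint P R := by
    rw [Finset.disjoint_left]
    intro x hx hx'
    exact (hRT x hx' t₀ ht₀).2 (hTP x hx t₀ ht₀)
  have hdPS : Disjoint P S := by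
    rw [Finset.disjoint_left]
    exact fun x hx => (memP.1 hx).2.1
  obtain ⟨v, hv, hvle⟩ := exists_mem_two_mul_inDeg_le (Q := P ∪ (S₁ ∪ R₁)) h hTcl ⟨t₀, ht₀⟩
    (by
      rw [Finset.disjoint_left]
      intro x hx hx'
      simp only [mem_union, hS₁, hR₁, mem_filter] at hx'
      rcases hx' with h1 | ⟨h1, -⟩ | ⟨h1, -⟩
      · exact (memP.1 h1).1 hx
      · exact (memS.1 h1).1 hx
      · exact (memR.1 h1).2.1 hx)
    (by
      intro t ht q hq
      simp only [mem_union, hS₁, hR₁, mem_filter] at hq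
      rcases hq with h1 | ⟨-, p, hp, hpq⟩ | ⟨-, p, hp, hpq⟩
      · exact Or.inl (hTP q h1 t ht)
      · exact Or.inr ⟨p, hTP p hp t ht, hpq⟩
      · exact Or.inr ⟨p, hTP p hp t ht, hpq⟩)
  have hdP : Disjoint P (S₁ ∪ R₁) := disjoint_union_right.2
    ⟨hdPS.mono_right (filter_subset _ _), hdPR.mono_right (filter_subset _ _)⟩
  have hdS : Disjoint S₁ R₁ := hdSR.mono (filter_subset _ _) (filter_subset _ _)
  rw [card_union_of_disjoint hdP, card_union_of_disjoint hdS, ← hS] at hvle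
  have hsul : 2 * D.inDeg v ≤ D.secondOutDeg v + D.outDeg v → D.IsSullivanTwo v := fun h1 => h1
  -- If `|P| = κ`, the set `R` is a second fragment.
  have hRfrag : P.card ≤ S.card → ∃ F', D.IsFragment U F' ∧ v ∉ F' := fun hle =>
    ⟨R, ⟨hRsep, fun T' h' => ((card_le_card hRb).trans hle).trans (hT.le T' h')⟩,
      fun h1 => (memR.1 h1).2.1 hv⟩
  by_cases hcase : (R \ R₁).Nonempty
  · have hsep : D.IsSeparated U (R \ R₁) :=
      ⟨hcase, sdiff_subset.trans (filter_subset _ _), t₀, hTU ht₀,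
        fun h1 => (memR.1 (mem_sdiff.1 h1).1).2.1 ht₀, fun r hr =>
          ⟨(hRT r (mem_sdiff.1 hr).1 t₀ ht₀).2, (hRT r (mem_sdiff.1 hr).1 t₀ ht₀).1⟩⟩
    have hb : D.inBoundary (R \ R₁) ⊆ R₁ := by
      intro x hx
      obtain ⟨hxR, r, hr, hxr⟩ := mem_inBoundary.1 hx
      obtain ⟨hrR, hrR₁⟩ := mem_sdiff.1 hr
      by_contra hx1
      have hxR' : x ∉ R := fun h1 => hxR (mem_sdiff.2 ⟨h1, hx1⟩)
      have hxP : x ∈ P := hRb (mem_inBoundary.2 ⟨hxR', r, hrR, hxr⟩)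
      exact hrR₁ (mem_filter.2 ⟨hrR, x, hxP, hxr⟩)
    have hR₁card : S.card ≤ R₁.card := (hT.le _ hsep).trans (card_le_card hb)
    by_cases hPk : P.card ≤ S.card
    · exact Or.inr ⟨v, hTF hv, hsul (by omega), hRfrag hPk⟩
    by_cases hRk : R₁.card ≤ S.card
    · exact Or.inr ⟨v, hTF hv, hsul (by omega), R \ R₁,
        ⟨hsep, fun T' h' => ((card_le_card hb).trans hRk).trans (hT.le T' h')⟩,
        fun h1 => (memR.1 (mem_sdiff.1 h1).1).2.1 hv⟩
    · exact Or.inl ⟨v, by omega⟩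
  · have hRsub : R ⊆ R₁ := sdiff_eq_empty_iff_subset.1 (not_nonempty_iff_eq_empty.1 hcase)
    have hReq : R₁ = R := (filter_subset _ _).antisymm hRsub
    rw [hReq] at hvle
    have hRpos : 0 < R.card := card_pos.2 ⟨w₀, hw₀R⟩
    by_cases hbig : S₂.card < R.card
    · by_cases hPk : P.card ≤ S.card
      · exact Or.inr ⟨v, hTF hv, hsul (by omega), hRfrag hPk⟩
      · exact Or.inl ⟨v, by omega⟩
    -- Now the missed part `S₂` of `S` is large, and its initial part takes over the role of `T`.
    obtain ⟨T₂, hT₂S, hT₂ne, hT₂str, hT₂in⟩ :=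
      exists_initial_subset (D := D) (S := S₂) (card_pos.1 (by omega))
    have hT₂S' : T₂ ⊆ S := hT₂S.trans (filter_subset _ _)
    have hPS₂ : ∀ p ∈ P, ∀ s ∈ S₂, ¬ D.Adj p s := fun p hp s hs ha =>
      (mem_filter.1 hs).2 ⟨p, hp, ha⟩
    have hTS₂ : ∀ t ∈ T, ∀ s ∈ S₂, ¬ D.Adj t s := fun t ht s hs ha =>
      (mem_filter.1 hs).2 (hTS t ht s (mem_filter.1 hs).1 ha)
    have hb : D.inBoundary T₂ ⊆ S₁ ∪ R := by
      intro x hx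
      obtain ⟨hxT₂, s, hs, hxs⟩ := mem_inBoundary.1 hx
      rcases hcover x ((hU.closed _ _ hxs).2 (hSU (hT₂S' hs))) with h1 | h1 | h1 | h1
      · exact absurd hxs (hTS₂ x h1 s (hT₂S hs))
      · refine mem_union_left _ (mem_filter.2 ⟨h1, ?_⟩)
        by_contra hx2
        exact hT₂in x (mem_filter.2 ⟨h1, hx2⟩) hxT₂ s hs hxs
      · exact absurd hxs (hPS₂ x h1 s (hT₂S hs))
      · exact mem_union_right _ h1
    have hbcard := (card_le_card hb).trans (card_union_le S₁ R)
    by_cases hsep : D.IsSeparated U T₂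
    · have hk := hT.le T₂ hsep
      rw [← hS] at hk
      refine Or.inr ⟨v, hTF hv, hsul (by omega), T₂,
        ⟨hsep, fun T' h' => ?_⟩, fun h1 => (memS.1 (hT₂S' h1)).1 hv⟩
      have := hT.le T' h'
      rw [← hS] at this
      omega
    · have hdom : ∀ x ∈ U, x ∉ T₂ → x ∉ D.inBoundary T₂ → ∀ s ∈ T₂, D.Adj s x := by
        intro x hx hxT hxb
        have hno : ∀ s ∈ T₂, ¬ D.Adj x s := fun s hs ha =>
          hxb (mem_inBoundary.2 ⟨hxT, s, hs, ha⟩)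
        refine hT₂str.dominates h hxT hno ?_
        by_contra hcon
        push Not at hcon
        exact hsep ⟨hT₂ne, hT₂S'.trans hSU, x, hx, hxT, fun s hs => ⟨hno s hs, hcon s hs⟩⟩
      have hT₂T : ∀ t ∈ T, ∀ s ∈ T₂, D.Adj s t := fun t ht =>
        hdom t (hTU ht) (fun h1 => (memS.1 (hT₂S' h1)).1 ht) fun h1 => by
          obtain ⟨-, s, hs, hts⟩ := mem_inBoundary.1 h1
          exact hTS₂ t ht s (hT₂S hs) hts
      have hT₂P : ∀ p ∈ P, ∀ s ∈ T₂, D.Adj s p := fun p hp =>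
        hdom p (hPU hp) (fun h1 => (memP.1 hp).2.1 (hT₂S' h1)) fun h1 => by
          obtain ⟨-, s, hs, hps⟩ := mem_inBoundary.1 h1
          exact hPS₂ p hp s (hT₂S hs) hps
      have hdTP : Disjoint T P := by
        rw [Finset.disjoint_left]
        exact fun x hx hx' => (memP.1 hx').1 hx
      have hdB : Disjoint (T ∪ P) (D.inBoundary T₂) := by
        rw [Finset.disjoint_left]
        intro x hx hx'
        rcases mem_union.1 (hb hx') with h1 | h1 <;> rcases mem_union.1 hx with h2 | h2
        · exact (memS.1 (mem_filter.1 h1).1).1 h2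
        · exact (memP.1 h2).2.1 (mem_filter.1 h1).1
        · exact (memR.1 h1).2.1 h2
        · exact Finset.disjoint_left.1 hdPR h2 h1
      obtain ⟨u, -, hule⟩ := exists_mem_two_mul_inDeg_le (Q := (T ∪ P) ∪ D.inBoundary T₂) h
        (h.isCliqueOn_of_dominates (hT₂T t₀ ht₀)) hT₂ne
        (by
          rw [Finset.disjoint_left]
          intro x hx hx'
          have hxS := hT₂S' hx
          simp only [mem_union] at hx'
          rcases hx' with (h1 | h1) | h1
          · exact (memS.1 hxS).1 h1
          · exact (memP.1 h1).2.1 hxS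
          · exact (mem_inBoundary.1 h1).1 hx)
        (by
          intro s hs q hq
          simp only [mem_union] at hq
          rcases hq with (h1 | h1) | h1
          · exact Or.inl (hT₂T q h1 s hs)
          · exact Or.inl (hT₂P q h1 s hs)
          · -- Both `S₁` and `R` lie in the out-neighbourhood of `P`.
            have : ∃ p ∈ P, D.Adj p q := by
              rcases mem_union.1 (hb h1) with h2 | h2
              · exact (mem_filter.1 h2).2
              · exact (mem_filter.1 (hRsub h2)).2
            obtain ⟨p, hp, hpq⟩ := this
            exact Or.inr ⟨p, hT₂P p hp s hs, hpq⟩)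
      rw [card_union_of_disjoint hdB, card_union_of_disjoint hdTP] at hule
      have hTpos : 0 < T.card := card_pos.2 ⟨t₀, ht₀⟩
      by_cases hlast : R.card = S₂.card ∧ P.card ≤ S.card
      · exact Or.inr ⟨v, hTF hv, hsul (by omega), hRfrag hlast.2⟩
      · exact Or.inl ⟨u, by omega⟩

/-! ### Components and the conclusion -/

theorem IsComponentSet.exists_two_of_not_isCliqueOn (h : D.IsLocalTournament) {U : Finset V}
    (hU : D.IsComponentSet U) (hc : ¬ D.IsCliqueOn U) :
    D.HasSlackVertex ∨ ∃ u v, u ≠ v ∧ D.IsSullivanTwo u ∧ D.IsSullivanTwo v := by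
  obtain ⟨F, hF⟩ := exists_isFragment hc
  rcases hF.exists_disjoint_fragment h hU with h1 | ⟨v, -, hv, F', hF', hvF'⟩
  · exact Or.inl h1
  rcases hF'.exists_disjoint_fragment h hU with h1 | ⟨u, hu, hu', -⟩
  · exact Or.inl h1
  · exact Or.inr ⟨u, v, fun e => hvF' (e ▸ hu), hu', hv⟩

theorem IsComponentSet.exists_isSullivanTwo_of_isCliqueOn (h : D.IsLocalTournament) {U : Finset V}
    (hU : D.IsComponentSet U) (hc : D.IsCliqueOn U) : ∃ v ∈ U, D.IsSullivanTwo v := by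
  obtain ⟨v, hv, hle⟩ := exists_mem_two_mul_inDeg_le (Q := ∅) h hc hU.nonempty
    (disjoint_empty_right _) (by simp)
  have hb : D.inBoundary U = ∅ := by
    refine eq_empty_of_forall_notMem fun x hx => ?_
    obtain ⟨hxU, u, hu, hxu⟩ := mem_inBoundary.1 hx
    exact hxU ((hU.closed _ _ hxu).2 hu)
  simp only [hb, card_empty, mul_zero, add_zero] at hle
  exact ⟨v, hv, hle⟩

theorem IsLocalTournament.exists_two_isSullivanTwo (h : D.IsLocalTournament)
    (hn : ¬ D.IsTournament) :
    D.HasSlackVertex ∨ ∃ u v, u ≠ v ∧ D.IsSullivanTwo u ∧ D.IsSullivanTwo v := by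
  have hpair : ∃ x y, x ≠ y ∧ ¬ D.Adj x y ∧ ¬ D.Adj y x := by
    by_contra hcon
    push Not at hcon
    refine hn ⟨h.loopless, fun x y hne => ?_, h.noTwoCycle⟩
    by_cases hxy : D.Adj x y
    · exact Or.inl hxy
    · exact Or.inr (hcon x y hne hxy)
  obtain ⟨x, y, hne, hxy, hyx⟩ := hpair
  obtain ⟨U, -, hU⟩ := exists_isComponentSet_subset (D := D) (W := univ) ⟨x, mem_univ x⟩ (by simp)
  by_cases hc : D.IsCliqueOn U
  · -- The complement of `U` is nonempty, since `x` and `y` are not both in the clique `U`.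
    have hcompl : (univ \ U).Nonempty := by
      by_contra he
      rw [not_nonempty_iff_eq_empty, sdiff_eq_empty_iff_subset] at he
      exact (hc x (he (mem_univ x)) y (he (mem_univ y)) hne).elim hxy hyx
    obtain ⟨U', hU's, hU'⟩ := exists_isComponentSet_subset (D := D) hcompl (fun a b hab => by
      simp [hU.closed a b hab])
    by_cases hc' : D.IsCliqueOn U'
    · obtain ⟨u, hu, hu'⟩ := hU.exists_isSullivanTwo_of_isCliqueOn h hc
      obtain ⟨v, hv, hv'⟩ := hU'.exists_isSullivanTwo_of_isCliqueOn h hc'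
      exact Or.inr ⟨u, v, fun e => (mem_sdiff.1 (hU's hv)).2 (e ▸ hu), hu', hv'⟩
    · exact hU'.exists_two_of_not_isCliqueOn h hc'
  · exact hU.exists_two_of_not_isCliqueOn h hc

end

end Digraph

theorem mainTheorem2 {V : Type*} [Finite V] (D : Digraph V)
    (hlocal : D.IsLocalTournament)
    (hnonround : ¬ D.IsRoundDecomposable)
    (hnontournament : ¬ D.IsTournament) :
    (∃ u v : V, u ≠ v ∧ D.IsSullivanTwo u ∧ D.IsSullivanTwo v) ∨
    (∃ v : V, D.IsSullivanTwo v ∧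
      D.secondOutDeg v + D.outDeg v ≥ 2 * D.inDeg v + 2) := by
  have := Fintype.ofFinite V
  rcases hlocal.exists_two_isSullivanTwo hnontournament with ⟨v, hv⟩ | h2
  · exact Or.inr ⟨v, by unfold Digraph.IsSullivanTwo; omega, hv⟩
  · exact Or.inl h2
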